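/- Let $p,q>1$ be real numbers, let $I\subseteq\mathbb{R}$ be a non-empty open interval, and let $\gamma: I\to(\mathbb{S}^3,h)$ be a smooth curve, parametrized by arc length, in the unit sphere $\mathbb{S}^3\subset\mathbb{R}^4$ with its standard metric $h$ and Levi-Civita connection $\nabla$. Suppose that $\gamma$ has constant geodesic curvature $k\ge 0$ and constant geodesic torsion $\tau$; that is, with $T=\gamma'$, there are smooth vector fields $N,B$ along $\gamma$, tangent to $\mathbb{S}^3$, such that $\{T,N,B\}$ is a positively oriented orthonormal frame along $\gamma$ and $$\nabla_TT=kN,\qquad \nabla_TN=-kT+\tau B,\qquad \nabla_TB=-\tau N .$$ The $p$-tension field of a curve $\gamma$ is $\tau_p(\gamma)=\nabla_{d/dt}\big(|\gamma'|^{p-2}\gamma'\big)$, and $\gamma$ is called $p$-harmonic if $\tau_p(\gamma)=0$ on $I$. It is called $(p,q)$-harmonic if, for every compact interval $D\subset I$, it is a critical point of $$E_{p,q}(\gamma;D)=\frac1q\int_D|\tau_p(\gamma)|^q\,dt$$ with respect to smooth variations of $\gamma$ in $\mathbb{S}^3$ supported in $D$, and proper $(p,q)$-harmonic if in addition it is not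 $p$-harmonic. Then $\gamma$ is proper $(p,q)$-harmonic if and only if $$k>0,\qquad \tau^2<1\qquad\text{and}\qquad p=\frac{1-\tau^2}{k^2}+1 .$$ -/

import Mathlib

open scoped ContDiff RealInnerProductSpace

noncomputable section

/-- The Euclidean space `ℝ⁴` in which the unit sphere `𝕊³` lies. -/
abbrev E4 : Type := EuclideanSpace ℝ (Fin 4)

/-- The standard unit sphere `𝕊³ ⊆ ℝ⁴`; its Riemannian metric `h` is the restriction of the
Euclidean inner product. -/
abbrev S3 : Set E4 := Metric.sphere (0 : E4) 1

/-- The Levi-Civita covariant derivative `∇_{d/dt} V` in `𝕊³` of a vector field `V` along a curve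
`γ` in `𝕊³`: the orthogonal projection of the Euclidean derivative `V'(t)` onto the tangent space
`T_{γ(t)} 𝕊³ = γ(t)^⊥` (recall that `‖γ(t)‖ = 1`). -/
def covDeriv (γ V : ℝ → E4) (t : ℝ) : E4 :=
  deriv V t - ⟪deriv V t, γ t⟫ • γ t

/-- The `p`-tension field `τ_p(γ) = div (|dγ|^{p-2} dγ) = ∇_{d/dt} (|γ'|^{p-2} γ')` of a curve. -/
def pTension (p : ℝ) (γ : ℝ → E4) (t : ℝ) : E4 :=
  covDeriv γ (fun u => ‖deriv γ u‖ ^ (p - 2) • deriv γ u) t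

/-- The `(p,q)`-energy `E_{p,q}(γ; D) = (1/q) ∫_D |τ_p(γ)|^q dt`. -/
def pqEnergy (p q : ℝ) (γ : ℝ → E4) (D : Set ℝ) : ℝ :=
  (1 / q) * ∫ t in D, ‖pTension p γ t‖ ^ q

/-- `Φ = (γ_s)_{s ∈ (-ε, ε)}`, `γ_s = Φ s`, is a smooth variation of the curve `γ : I → 𝕊³`
through curves in `𝕊³`, supported in `D`. -/
structure IsVariation (I D : Set ℝ) (γ : ℝ → E4) (ε : ℝ) (Φ : ℝ → ℝ → E4) : Prop where
  eps_pos : 0 < ε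
  smooth : ContDiffOn ℝ ∞ (fun x : ℝ × ℝ => Φ x.1 x.2) (Set.Ioo (-ε) ε ×ˢ I)
  mem_sphere : ∀ s ∈ Set.Ioo (-ε) ε, ∀ t ∈ I, Φ s t ∈ S3
  zero : ∀ t ∈ I, Φ 0 t = γ t
  support : ∀ s ∈ Set.Ioo (-ε) ε, ∀ t ∈ I \ D, Φ s t = γ t

/-- The curve `γ : I → 𝕊³` is `p`-harmonic: its `p`-tension field vanishes on `I`. -/
def IsPHarmonic (p : ℝ) (I : Set ℝ) (γ : ℝ → E4) : Prop :=
  ∀ t ∈ I, pTension p γ t = 0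

/-- The curve `γ : I → 𝕊³` is `(p,q)`-harmonic: it is a critical point of the `(p,q)`-energy on
every compact interval `D = [a, b] ⊆ I`, with respect to all smooth variations supported in `D`. -/
def IsPQHarmonic (p q : ℝ) (I : Set ℝ) (γ : ℝ → E4) : Prop :=
  ∀ a b : ℝ, a < b → Set.Icc a b ⊆ I →
    ∀ (ε : ℝ) (Φ : ℝ → ℝ → E4), IsVariation I (Set.Icc a b) γ ε Φ →
      HasDerivAt (fun s => pqEnergy p q (Φ s) (Set.Icc a b)) 0 0

/-- A `(p,q)`-harmonic curve is proper if it is not `p`-harmonic. -/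
def IsProperPQHarmonic (p q : ℝ) (I : Set ℝ) (γ : ℝ → E4) : Prop :=
  IsPQHarmonic p q I γ ∧ ¬ IsPHarmonic p I γ

/-- `(T, N, B)` with `T = γ'` is a Frenet frame along the curve `γ : I → 𝕊³`, with geodesic
curvature `k ≥ 0` and geodesic torsion `τ`: an orthonormal, positively oriented frame of
`T_γ 𝕊³` that satisfies the Frenet equations. In particular `γ` is parametrized by arc length.
A frame of `T_{γ(t)} 𝕊³` is positively oriented if, preceded by the outward unit normal `γ(t)`, it
is a positively oriented basis of `ℝ⁴`. -/
structure IsFrenetFrame (I : Set ℝ) (γ N B : ℝ → E4) (k τ : ℝ → ℝ) : Prop where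
  smooth_N : ContDiffOn ℝ ∞ N I
  smooth_B : ContDiffOn ℝ ∞ B I
  curvature_nonneg : ∀ t ∈ I, 0 ≤ k t
  tangent : ∀ t ∈ I, ⟪deriv γ t, γ t⟫ = 0 ∧ ⟪N t, γ t⟫ = 0 ∧ ⟪B t, γ t⟫ = 0
  orthonormal : ∀ t ∈ I, Orthonormal ℝ ![deriv γ t, N t, B t]
  oriented : ∀ t ∈ I,
    0 < (Matrix.of fun i j : Fin 4 => (![γ t, deriv γ t, N t, B t] i) j).det
  frenet_T : ∀ t ∈ I, covDeriv γ (deriv γ) t = k t • N t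
  frenet_N : ∀ t ∈ I, covDeriv γ N t = -(k t) • deriv γ t + τ t • B t
  frenet_B : ∀ t ∈ I, covDeriv γ B t = -(τ t) • N t

/-- The curve `γ : I → 𝕊³` has geodesic curvature `k` and geodesic torsion `τ` (as functions on
`I`) with respect to some Frenet frame along `γ`. -/
def HasCurvatureTorsion (I : Set ℝ) (γ : ℝ → E4) (k τ : ℝ → ℝ) : Prop :=
  ∃ N B : ℝ → E4, IsFrenetFrame I γ N B k τ

end

/-!
The first variation of the `(p,q)`-energy at a curve with constant curvature `k > 0` and constant
torsion `τ` is computed explicitly. For such a curve `τ_p(γ) = k N` has constant norm `k ≠ 0`, so on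
a compact interval `D` the tension fields of the curves of a variation have no zeros for small
parameters, the energy density is smooth, and one may differentiate under the integral sign. If `V`
is the variation field, the variation of the momentum `|γ'|^{p-2} γ'` is
`X = (p - 2) ⟪T, V'⟫ T + V'`, and the derivative of the energy is
`k^{q-1} ∫_D (⟪N, X'⟫ + ⟪N, V⟫)`; the second term comes from the projection onto the tangent space.
Integrating by parts twice and using the Frenet equations in `ℝ⁴`, in particular
`T' = k N - γ` and `⟪γ, V⟫ = 0`, turns this into
`k^{q-1} (1 - τ² - k² (p - 1)) ∫_D ⟪N, V⟫` (`IsFrenetFrame.hasDerivAt_pqEnergy`).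

Hence `γ` is critical as soon as `k² (p - 1) = 1 - τ²`, and, conversely, the variation that moves
the points of `γ` along great circles in direction `φ N`, with `φ` a bump function, shows that this
is necessary (`IsFrenetFrame.eq_zero_of_isPQHarmonic`). Properness amounts to `k ≠ 0`, and
`τ² < 1` follows from `p > 1`.
-/

/-! ### Partial derivatives of two-parameter maps -/

section PartialDerivatives

open Set Filter Topology MeasureTheory

variable {E : Type*} [NormedAddCommGroup E] [NormedSpace ℝ E]

/-- The partial derivative `∂f/∂s` of a map `(s, t) ↦ f (s, t)`, where `s` is the parameter of a
variation. -/
noncomputable def partialS (f : ℝ × ℝ → E) (x : ℝ × ℝ) : E := fderiv ℝ f x (1, 0)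

/-- The partial derivative `∂f/∂t` of a map `(s, t) ↦ f (s, t)`, where `t` is the parameter of the
curves of a variation. -/
noncomputable def partialT (f : ℝ × ℝ → E) (x : ℝ × ℝ) : E := fderiv ℝ f x (0, 1)

lemma hasDerivAt_partialS {f : ℝ × ℝ → E} {s t : ℝ} (hf : DifferentiableAt ℝ f (s, t)) :
    HasDerivAt (fun s => f (s, t)) (partialS f (s, t)) s :=
  hf.hasFDerivAt.comp_hasDerivAt s ((hasDerivAt_id s).prodMk (hasDerivAt_const s t))

lemma hasDerivAt_partialT {f : ℝ × ℝ → E} {s t : ℝ} (hf : DifferentiableAt ℝ f (s, t)) :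
    HasDerivAt (fun t => f (s, t)) (partialT f (s, t)) t :=
  hf.hasFDerivAt.comp_hasDerivAt t ((hasDerivAt_const t s).prodMk (hasDerivAt_id t))

lemma ContDiffOn.partialS {f : ℝ × ℝ → E} {U : Set (ℝ × ℝ)} (hf : ContDiffOn ℝ ∞ f U)
    (hU : IsOpen U) : ContDiffOn ℝ ∞ (partialS f) U :=
  (hf.fderiv_of_isOpen hU (by simp)).clm_apply contDiffOn_const

lemma ContDiffOn.partialT {f : ℝ × ℝ → E} {U : Set (ℝ × ℝ)} (hf : ContDiffOn ℝ ∞ f U)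
    (hU : IsOpen U) : ContDiffOn ℝ ∞ (partialT f) U :=
  (hf.fderiv_of_isOpen hU (by simp)).clm_apply contDiffOn_const

lemma ContDiffOn.differentiableAt_of_isOpen {F : Type*} [NormedAddCommGroup F] [NormedSpace ℝ F]
    {f : F → E} {U : Set F} (hf : ContDiffOn ℝ ∞ f U) (hU : IsOpen U) {x : F} (hx : x ∈ U) :
    DifferentiableAt ℝ f x :=
  (hf.contDiffAt (hU.mem_nhds hx)).differentiableAt (by simp)

lemma partialS_partialT {f : ℝ × ℝ → E} {U : Set (ℝ × ℝ)} (hf : ContDiffOn ℝ ∞ f U)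
    (hU : IsOpen U) {x : ℝ × ℝ} (hx : x ∈ U) :
    partialS (partialT f) x = partialT (partialS f) x := by
  have hd : DifferentiableAt ℝ (fderiv ℝ f) x :=
    (hf.fderiv_of_isOpen hU (m := ∞) (by simp)).differentiableAt_of_isOpen hU hx
  have h (u v : ℝ × ℝ) :
      fderiv ℝ (fun y => fderiv ℝ f y u) x v = fderiv ℝ (fderiv ℝ f) x v u := by
    rw [fderiv_clm_apply hd (differentiableAt_const u)]
    simp
  have hsymm : IsSymmSndFDerivAt ℝ f x :=
    (hf.contDiffAt (hU.mem_nhds hx)).isSymmSndFDerivAt (by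
      rw [minSmoothness_of_isRCLikeNormedField]; exact WithTop.coe_le_coe.2 (le_top : (2 : ℕ∞) ≤ ⊤))
  change fderiv ℝ (fun y => fderiv ℝ f y (0, 1)) x (1, 0) =
    fderiv ℝ (fun y => fderiv ℝ f y (1, 0)) x (0, 1)
  rw [h, h, hsymm.eq]

lemma eventually_forall_Icc_mem_of_isOpen {U : Set (ℝ × ℝ)} (hU : IsOpen U) {s a b : ℝ}
    (h : ∀ t ∈ Icc a b, (s, t) ∈ U) : ∀ᶠ r in 𝓝 s, ∀ t ∈ Icc a b, (r, t) ∈ U :=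
  isCompact_Icc.eventually_forall_of_forall_eventually fun t ht => hU.mem_nhds (h t ht)

/-- Differentiation under the integral sign over a compact interval. -/
lemma hasDerivAt_setIntegral_Icc {G : ℝ × ℝ → ℝ} {U : Set (ℝ × ℝ)} (hU : IsOpen U)
    (hG : ContDiffOn ℝ ∞ G U) {s a b : ℝ} (h : ∀ t ∈ Icc a b, (s, t) ∈ U) :
    HasDerivAt (fun s => ∫ t in Icc a b, G (s, t)) (∫ t in Icc a b, partialS G (s, t)) s := by
  obtain ⟨δ, hδ, hball⟩ := Metric.nhds_basis_closedBall.eventually_iff.1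
    (eventually_forall_Icc_mem_of_isOpen hU h)
  have hK : Metric.closedBall s δ ×ˢ Icc a b ⊆ U := fun x hx => hball hx.1 x.2 hx.2
  obtain ⟨C, hC⟩ := ((isCompact_closedBall s δ).prod isCompact_Icc).exists_bound_of_continuousOn
    ((hG.partialS hU).continuousOn.mono hK)
  have hslice {f : ℝ × ℝ → ℝ} (hf : ContinuousOn f U) {r : ℝ} (hr : r ∈ Metric.closedBall s δ) :
      ContinuousOn (fun t => f (r, t)) (Icc a b) :=
    hf.comp (by fun_prop) fun t ht => hK ⟨hr, ht⟩
  have hs : s ∈ Metric.closedBall s δ := Metric.mem_closedBall_self hδ.le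
  refine (hasDerivAt_integral_of_dominated_loc_of_deriv_le (bound := fun _ => C)
    (F := fun r t => G (r, t)) (F' := fun r t => partialS G (r, t))
    (Metric.closedBall_mem_nhds s hδ) ?_ ?_ ?_ ?_ ?_ ?_).2
  · filter_upwards [Metric.closedBall_mem_nhds s hδ] with r hr
    exact (hslice hG.continuousOn hr).aestronglyMeasurable measurableSet_Icc
  · exact (hslice hG.continuousOn hs).integrableOn_Icc
  · exact (hslice (hG.partialS hU).continuousOn hs).aestronglyMeasurable measurableSet_Icc
  · filter_upwards [ae_restrict_mem measurableSet_Icc] with t ht r hr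
    exact hC (r, t) ⟨hr, ht⟩
  · exact integrableOn_const (by simp)
  · filter_upwards [ae_restrict_mem measurableSet_Icc] with t ht r hr
    exact hasDerivAt_partialS (hG.differentiableAt_of_isOpen hU (hK ⟨hr, ht⟩))

/-- A continuous function on an open set that vanishes off a compact interval vanishes at the
endpoints too. -/
lemma eq_zero_endpoints {X : Type*} [TopologicalSpace X] [T2Space X] [Zero X] {I : Set ℝ}
    (hI : IsOpen I) {g : ℝ → X} (hg : ContinuousOn g I)
    {a b : ℝ} (hab : a ≤ b) (hD : Icc a b ⊆ I) (h0 : ∀ t ∈ I \ Icc a b, g t = 0) :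
    g a = 0 ∧ g b = 0 := by
  have haI := hD (left_mem_Icc.2 hab)
  have hbI := hD (right_mem_Icc.2 hab)
  have ha : Tendsto g (𝓝[<] a) (𝓝 (g a)) :=
    (hg.continuousAt (hI.mem_nhds haI)).tendsto.mono_left nhdsWithin_le_nhds
  have hb : Tendsto g (𝓝[>] b) (𝓝 (g b)) :=
    (hg.continuousAt (hI.mem_nhds hbI)).tendsto.mono_left nhdsWithin_le_nhds
  constructor
  · refine tendsto_nhds_unique_of_eventuallyEq ha tendsto_const_nhds ?_
    filter_upwards [self_mem_nhdsWithin, nhdsWithin_le_nhds (hI.mem_nhds haI)] with t ht htI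
    exact h0 t ⟨htI, fun h => absurd h.1 (not_le.2 ht)⟩
  · refine tendsto_nhds_unique_of_eventuallyEq hb tendsto_const_nhds ?_
    filter_upwards [self_mem_nhdsWithin, nhdsWithin_le_nhds (hI.mem_nhds hbI)] with t ht htI
    exact h0 t ⟨htI, fun h => absurd h.2 (not_le.2 ht)⟩

end PartialDerivatives

/-! ### Derivatives of powers of the norm -/

section NormPowers

variable {E : Type*} [NormedAddCommGroup E] [InnerProductSpace ℝ E]

lemma HasDerivAt.norm_rpow_of_ne_zero {f : ℝ → E} {f' : E} {x : ℝ} (hf : HasDerivAt f f' x)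
    (h0 : f x ≠ 0) (r : ℝ) :
    HasDerivAt (fun y => ‖f y‖ ^ r) (r * ‖f x‖ ^ (r - 2) * ⟪f x, f'⟫) x := by
  have hpos : 0 < ‖f x‖ := norm_pos_iff.2 h0
  have h : HasDerivAt (fun y => (‖f y‖ ^ 2) ^ (r / 2)) _ x :=
    hf.norm_sq.rpow_const (Or.inl (by positivity))
  have hpow (y : E) (c : ℝ) : (‖y‖ ^ 2) ^ (c / 2) = ‖y‖ ^ c := by
    rw [← Real.rpow_natCast, ← Real.rpow_mul (norm_nonneg y)]
    congr 1
    push_cast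
    ring
  simp only [hpow] at h
  refine h.congr_deriv ?_
  rw [show r / 2 - 1 = (r - 2) / 2 by ring, hpow]
  ring

lemma HasDerivAt.norm_rpow_smul_of_norm_eq_one {f : ℝ → E} {f' : E} {x : ℝ}
    (hf : HasDerivAt f f' x) (h1 : ‖f x‖ = 1) (r : ℝ) :
    HasDerivAt (fun y => ‖f y‖ ^ r • f y) ((r * ⟪f x, f'⟫) • f x + f') x := by
  have h := (hf.norm_rpow_of_ne_zero (norm_ne_zero_iff.1 (by simp [h1])) r).smul hf
  refine h.congr_deriv ?_
  simp [h1, add_comm]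

lemma ContDiffOn.norm_rpow_of_ne_zero {F : Type*} [NormedAddCommGroup F] [NormedSpace ℝ F]
    {f : F → E} {U : Set F} (hf : ContDiffOn ℝ ∞ f U) (h0 : ∀ x ∈ U, f x ≠ 0) (r : ℝ) :
    ContDiffOn ℝ ∞ (fun x => ‖f x‖ ^ r) U :=
  (hf.norm ℝ h0).rpow_const_of_ne fun x hx => norm_ne_zero_iff.2 (h0 x hx)

end NormPowers

/-! ### Frenet equations in `ℝ⁴` -/

section Frenet

open Set Filter Topology

variable {I : Set ℝ} {γ N B : ℝ → E4} {k τ : ℝ → ℝ}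

/-- Gauss formula: the Euclidean derivative of a tangent field along a curve in the sphere is its
covariant derivative plus a multiple of the position vector. -/
lemma hasDerivAt_of_tangent (hI : IsOpen I) (hγ : ContDiffOn ℝ ∞ γ I) {V : ℝ → E4}
    (hV : ContDiffOn ℝ ∞ V I) (hVγ : ∀ t ∈ I, ⟪V t, γ t⟫ = 0) {t : ℝ} (ht : t ∈ I) :
    HasDerivAt V (covDeriv γ V t - ⟪V t, deriv γ t⟫ • γ t) t := by
  have hV' := (hV.differentiableAt_of_isOpen hI ht).hasDerivAt
  have h : HasDerivAt (fun u => ⟪V u, γ u⟫) _ t :=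
    hV'.inner ℝ (hγ.differentiableAt_of_isOpen hI ht).hasDerivAt
  have h0 : (fun u => ⟪V u, γ u⟫) =ᶠ[𝓝 t] fun _ => 0 := by
    filter_upwards [hI.mem_nhds ht] with u hu using hVγ u hu
  have h1 := h.unique ((hasDerivAt_const t (0 : ℝ)).congr_of_eventuallyEq h0)
  refine hV'.congr_deriv ?_
  rw [covDeriv, show ⟪V t, deriv γ t⟫ = -⟪deriv V t, γ t⟫ by linarith]
  module

lemma IsFrenetFrame.norm_tangent (hF : IsFrenetFrame I γ N B k τ) {t : ℝ} (ht : t ∈ I) :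
    ‖deriv γ t‖ = 1 := (hF.orthonormal t ht).1 0

lemma IsFrenetFrame.norm_normal (hF : IsFrenetFrame I γ N B k τ) {t : ℝ} (ht : t ∈ I) :
    ‖N t‖ = 1 := (hF.orthonormal t ht).1 1

lemma IsFrenetFrame.inner_normal_tangent (hF : IsFrenetFrame I γ N B k τ) {t : ℝ} (ht : t ∈ I) :
    ⟪N t, deriv γ t⟫ = 0 :=
  (hF.orthonormal t ht).2 (i := 1) (j := 0) (by decide)

lemma IsFrenetFrame.inner_binormal_tangent (hF : IsFrenetFrame I γ N B k τ) {t : ℝ}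
    (ht : t ∈ I) : ⟪B t, deriv γ t⟫ = 0 :=
  (hF.orthonormal t ht).2 (i := 2) (j := 0) (by decide)

lemma IsFrenetFrame.hasDerivAt_tangent (hF : IsFrenetFrame I γ N B k τ) (hI : IsOpen I)
    (hγ : ContDiffOn ℝ ∞ γ I) {t : ℝ} (ht : t ∈ I) :
    HasDerivAt (deriv γ) (k t • N t - γ t) t := by
  refine (hasDerivAt_of_tangent hI hγ (hγ.deriv_of_isOpen hI (by simp))
    (fun t ht => (hF.tangent t ht).1) ht).congr_deriv ?_
  rw [hF.frenet_T t ht, real_inner_self_eq_norm_sq, hF.norm_tangent ht]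
  simp

lemma IsFrenetFrame.hasDerivAt_normal (hF : IsFrenetFrame I γ N B k τ) (hI : IsOpen I)
    (hγ : ContDiffOn ℝ ∞ γ I) {t : ℝ} (ht : t ∈ I) :
    HasDerivAt N (-(k t) • deriv γ t + τ t • B t) t := by
  refine (hasDerivAt_of_tangent hI hγ hF.smooth_N
    (fun t ht => (hF.tangent t ht).2.1) ht).congr_deriv ?_
  rw [hF.frenet_N t ht, hF.inner_normal_tangent ht]
  simp

lemma IsFrenetFrame.hasDerivAt_binormal (hF : IsFrenetFrame I γ N B k τ) (hI : IsOpen I)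
    (hγ : ContDiffOn ℝ ∞ γ I) {t : ℝ} (ht : t ∈ I) :
    HasDerivAt B (-(τ t) • N t) t := by
  refine (hasDerivAt_of_tangent hI hγ hF.smooth_B
    (fun t ht => (hF.tangent t ht).2.2) ht).congr_deriv ?_
  rw [hF.frenet_B t ht, hF.inner_binormal_tangent ht]
  simp

lemma IsFrenetFrame.pTension_eq (hF : IsFrenetFrame I γ N B k τ) (hI : IsOpen I) (p : ℝ) {t : ℝ}
    (ht : t ∈ I) : pTension p γ t = k t • N t := by
  have h : (fun u => ‖deriv γ u‖ ^ (p - 2) • deriv γ u) =ᶠ[𝓝 t] deriv γ := by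
    filter_upwards [hI.mem_nhds ht] with u hu
    simp [hF.norm_tangent hu]
  rw [pTension, covDeriv, h.deriv_eq]
  exact hF.frenet_T t ht

lemma IsFrenetFrame.isPHarmonic_iff {k τ : ℝ} (hF : IsFrenetFrame I γ N B (fun _ => k) fun _ => τ)
    (hI : IsOpen I) (hne : I.Nonempty) (p : ℝ) : IsPHarmonic p I γ ↔ k = 0 := by
  constructor
  · intro h
    obtain ⟨t, ht⟩ := hne
    have h0 := h t ht
    rw [hF.pTension_eq hI p ht] at h0
    have hN : N t ≠ 0 := norm_ne_zero_iff.1 (by simp [hF.norm_normal ht])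
    exact (smul_eq_zero.1 h0).resolve_right hN
  · rintro rfl t ht
    rw [hF.pTension_eq hI p ht, zero_smul]

end Frenet

/-! ### The tension field of a variation as a two-parameter map -/

section TwoParameter

open Set Filter Topology

/-- The momentum `|∂F/∂t|^{p-2} ∂F/∂t` of the curves `t ↦ F (s, t)`. -/
noncomputable def momentum (p : ℝ) (F : ℝ × ℝ → E4) (x : ℝ × ℝ) : E4 :=
  ‖partialT F x‖ ^ (p - 2) • partialT F x

/-- The `p`-tension field of the curves `t ↦ F (s, t)`, expressed by partial derivatives of `F`. -/
noncomputable def tensionField (p : ℝ) (F : ℝ × ℝ → E4) (x : ℝ × ℝ) : E4 :=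
  partialT (momentum p F) x - ⟪partialT (momentum p F) x, F x⟫ • F x

variable {p : ℝ} {F : ℝ × ℝ → E4} {U : Set (ℝ × ℝ)}

lemma contDiffOn_momentum (hU : IsOpen U) (hF : ContDiffOn ℝ ∞ F U)
    (h0 : ∀ x ∈ U, partialT F x ≠ 0) : ContDiffOn ℝ ∞ (momentum p F) U :=
  ((hF.partialT hU).norm_rpow_of_ne_zero h0 _).smul (hF.partialT hU)

lemma contDiffOn_tensionField (hU : IsOpen U) (hF : ContDiffOn ℝ ∞ F U)
    (h0 : ∀ x ∈ U, partialT F x ≠ 0) : ContDiffOn ℝ ∞ (tensionField p F) U := by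
  have h := (contDiffOn_momentum (p := p) hU hF h0).partialT hU
  exact h.sub ((h.inner ℝ hF).smul hF)

lemma eventually_mem_slice (hU : IsOpen U) {s t : ℝ} (hx : (s, t) ∈ U) :
    ∀ᶠ u in 𝓝 t, (s, u) ∈ U :=
  (Continuous.prodMk_right s).continuousAt.eventually (hU.mem_nhds hx)

lemma pTension_eq_tensionField (hU : IsOpen U) (hF : ContDiffOn ℝ ∞ F U)
    (h0 : ∀ x ∈ U, partialT F x ≠ 0) {s t : ℝ} (hx : (s, t) ∈ U) :
    pTension p (fun t => F (s, t)) t = tensionField p F (s, t) := by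
  have h : (fun u => ‖deriv (fun t => F (s, t)) u‖ ^ (p - 2) • deriv (fun t => F (s, t)) u)
      =ᶠ[𝓝 t] fun u => momentum p F (s, u) := by
    filter_upwards [eventually_mem_slice hU hx] with u hu
    rw [(hasDerivAt_partialT (hF.differentiableAt_of_isOpen hU hu)).deriv, momentum]
  have hd := hasDerivAt_partialT
    ((contDiffOn_momentum (p := p) hU hF h0).differentiableAt_of_isOpen hU hx)
  rw [pTension, covDeriv, h.deriv_eq, hd.deriv, tensionField]

/-- Infinitesimal variation of the momentum at a unit speed curve. -/
lemma partialS_momentum (hU : IsOpen U) (hF : ContDiffOn ℝ ∞ F U)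
    (h0 : ∀ x ∈ U, partialT F x ≠ 0) {s t : ℝ} (hx : (s, t) ∈ U) (h1 : ‖partialT F (s, t)‖ = 1) :
    partialS (momentum p F) (s, t) =
      ((p - 2) * ⟪partialT F (s, t), partialT (partialS F) (s, t)⟫) • partialT F (s, t)
        + partialT (partialS F) (s, t) := by
  have h := hasDerivAt_partialS
    ((contDiffOn_momentum (p := p) hU hF h0).differentiableAt_of_isOpen hU hx)
  have h' := (hasDerivAt_partialS ((hF.partialT hU).differentiableAt_of_isOpen hU hx))
    |>.norm_rpow_smul_of_norm_eq_one h1 (p - 2)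
  rw [partialS_partialT hF hU hx] at h'
  exact h.unique h'

/-- Infinitesimal variation of the `p`-tension field, tested against a vector `n` tangent to the
sphere. -/
lemma inner_partialS_tensionField (hU : IsOpen U) (hF : ContDiffOn ℝ ∞ F U)
    (h0 : ∀ x ∈ U, partialT F x ≠ 0) {s t : ℝ} (hx : (s, t) ∈ U) {n : E4}
    (hn : ⟪n, F (s, t)⟫ = 0) :
    ⟪n, partialS (tensionField p F) (s, t)⟫ = ⟪n, partialT (partialS (momentum p F)) (s, t)⟫
      - ⟪partialT (momentum p F) (s, t), F (s, t)⟫ * ⟪n, partialS F (s, t)⟫ := by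
  have hW := contDiffOn_momentum (p := p) hU hF h0
  have hW' := hasDerivAt_partialS ((hW.partialT hU).differentiableAt_of_isOpen hU hx)
  have hF' := hasDerivAt_partialS (hF.differentiableAt_of_isOpen hU hx)
  have h := hasDerivAt_partialS
    ((contDiffOn_tensionField (p := p) hU hF h0).differentiableAt_of_isOpen hU hx)
  rw [h.unique (hW'.sub ((hW'.inner ℝ hF').smul hF')), partialS_partialT hW hU hx]
  simp [inner_sub_right, inner_add_right, inner_smul_right, hn]

end TwoParameter

/-! ### The first variation formula -/

section FirstVariation

open Set Filter Topology MeasureTheory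

variable {I : Set ℝ} {γ N B : ℝ → E4}

/-- Integration by parts: up to the derivative of a function that vanishes at the endpoints, the
infinitesimal variation of the `p`-tension field in direction `N` is a multiple of the normal
component `⟪N, V⟫` of the variation field. Here `X` is the variation of the momentum. -/
lemma IsFrenetFrame.integral_inner_normal {p k τ : ℝ}
    (hF : IsFrenetFrame I γ N B (fun _ => k) fun _ => τ)
    (hI : IsOpen I) (hγ : ContDiffOn ℝ ∞ γ I) {a b : ℝ} (hab : a ≤ b) (hD : Icc a b ⊆ I)
    {V V' X X' : ℝ → E4} (hV : ∀ t ∈ I, HasDerivAt V (V' t) t)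
    (hX : ∀ t ∈ I, HasDerivAt X (X' t) t) (hX'c : ContinuousOn X' I)
    (hXV : ∀ t ∈ I, X t = ((p - 2) * ⟪deriv γ t, V' t⟫) • deriv γ t + V' t)
    (hVγ : ∀ t ∈ I, ⟪V t, γ t⟫ = 0)
    (hVa : V a = 0) (hVb : V b = 0) (hXa : X a = 0) (hXb : X b = 0) :
    ∫ t in Icc a b, (⟪N t, X' t⟫ + ⟪N t, V t⟫) =
      (1 - τ ^ 2 - k ^ 2 * (p - 1)) * ∫ t in Icc a b, ⟪N t, V t⟫ := by
  have hVc : ContinuousOn V I := fun t ht => (hV t ht).continuousAt.continuousWithinAt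
  have hint {Y : ℝ → E4} (hY : ContinuousOn Y I) :
      IntegrableOn (fun t => ⟪N t, Y t⟫) (Icc a b) :=
    ((hF.smooth_N.continuousOn.inner hY).mono hD).integrableOn_Icc
  set c := 1 - τ ^ 2 - k ^ 2 * (p - 1) with hc
  -- The boundary term `⟪N, X⟫ - ⟪N', V⟫ + k (p - 2) ⟪T, V⟫`, with `N' = -k T + τ B` inserted.
  set ψ : ℝ → ℝ := fun t => ⟪N t, X t⟫ - τ * ⟪B t, V t⟫ + k * (p - 1) * ⟪deriv γ t, V t⟫ with hψ
  have hψ' : ∀ t ∈ I, HasDerivAt ψ ((⟪N t, X' t⟫ + ⟪N t, V t⟫) - c * ⟪N t, V t⟫) t := by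
    intro t ht
    have h := (((hF.hasDerivAt_normal hI hγ ht).inner ℝ (hX t ht)).sub
      (((hF.hasDerivAt_binormal hI hγ ht).inner ℝ (hV t ht)).const_mul τ)).add
      (((hF.hasDerivAt_tangent hI hγ ht).inner ℝ (hV t ht)).const_mul (k * (p - 1)))
    refine h.congr_deriv ?_
    have hTT : ⟪deriv γ t, deriv γ t⟫ = 1 := by
      rw [real_inner_self_eq_norm_sq, hF.norm_tangent ht, one_pow]
    have hγV : ⟪γ t, V t⟫ = 0 := by rw [real_inner_comm, hVγ t ht]
    rw [hXV t ht]
    simp only [inner_add_left, inner_sub_left, inner_add_right, real_inner_smul_left,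
      real_inner_smul_right, hTT, hF.inner_binormal_tangent ht, hγV, hc]
    ring
  have hadd : IntegrableOn (fun t => ⟪N t, X' t⟫ + ⟪N t, V t⟫) (Icc a b) :=
    (hint hX'c).add (hint hVc)
  have hψint : IntegrableOn (fun t => (⟪N t, X' t⟫ + ⟪N t, V t⟫) - c * ⟪N t, V t⟫) (Icc a b) :=
    hadd.sub ((hint hVc).const_mul c)
  have hftc : ∫ t in Icc a b, ((⟪N t, X' t⟫ + ⟪N t, V t⟫) - c * ⟪N t, V t⟫) = 0 := by
    rw [integral_Icc_eq_integral_Ioc, ← intervalIntegral.integral_of_le hab,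
      intervalIntegral.integral_eq_sub_of_hasDerivAt (f := ψ)]
    · simp [hψ, hVa, hVb, hXa, hXb]
    · rw [uIcc_of_le hab]
      exact fun t ht => hψ' t (hD ht)
    · rw [intervalIntegrable_iff_integrableOn_Icc_of_le hab]
      exact hψint
  rw [integral_sub hadd ((hint hVc).const_mul c), integral_const_mul, sub_eq_zero] at hftc
  exact hftc

/-- The first variation of the `(p,q)`-energy at a curve of constant curvature `k > 0` and constant
torsion `τ`. Since `k > 0`, the tension field of the varied curves has no zeros on `[a, b]`
for small parameters, so that the energy density depends smoothly on the parameter. -/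
theorem IsFrenetFrame.hasDerivAt_pqEnergy {p q k τ : ℝ} (hq : q ≠ 0)
    (hF : IsFrenetFrame I γ N B (fun _ => k) fun _ => τ) (hI : IsOpen I)
    (hγ : ContDiffOn ℝ ∞ γ I) (hk : 0 < k) {a b : ℝ} (hab : a ≤ b) (hD : Icc a b ⊆ I)
    {ε : ℝ} {Φ : ℝ → ℝ → E4} (hΦ : IsVariation I (Icc a b) γ ε Φ) :
    HasDerivAt (fun s => pqEnergy p q (Φ s) (Icc a b))
      (k ^ (q - 1) * ((1 - τ ^ 2 - k ^ 2 * (p - 1)) *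
        ∫ t in Icc a b, ⟪N t, deriv (fun s => Φ s t) 0⟫)) 0 := by
  set F : ℝ × ℝ → E4 := fun x => Φ x.1 x.2
  have h0ε : (0 : ℝ) ∈ Ioo (-ε) ε := ⟨neg_lt_zero.2 hΦ.eps_pos, hΦ.eps_pos⟩
  have hU₀ : IsOpen (Ioo (-ε) ε ×ˢ I) := isOpen_Ioo.prod hI
  have hF₀ : ContDiffOn ℝ ∞ F (Ioo (-ε) ε ×ˢ I) := hΦ.smooth
  -- The open set of parameters at which the varied curves are immersed.
  set U : Set (ℝ × ℝ) := (Ioo (-ε) ε ×ˢ I) ∩ partialT F ⁻¹' {0}ᶜ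
  have hU : IsOpen U :=
    (hF₀.partialT hU₀).continuousOn.isOpen_inter_preimage hU₀ isOpen_compl_singleton
  have hFU : ContDiffOn ℝ ∞ F U := hF₀.mono inter_subset_left
  have hne : ∀ x ∈ U, partialT F x ≠ 0 := fun x hx => hx.2
  have hFγ : ∀ t ∈ I, F (0, t) = γ t := hΦ.zero
  have hslice {f : ℝ × ℝ → E4} {g : ℝ → E4} (hfg : ∀ t ∈ I, f (0, t) = g t) {t : ℝ} (ht : t ∈ I) :
      (fun t => f (0, t)) =ᶠ[𝓝 t] g := by
    filter_upwards [hI.mem_nhds ht] with u hu using hfg u hu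
  have hFT : ∀ t ∈ I, partialT F (0, t) = deriv γ t := fun t ht => by
    rw [← (hslice hFγ ht).deriv_eq]
    exact (hasDerivAt_partialT (hF₀.differentiableAt_of_isOpen hU₀ ⟨h0ε, ht⟩)).deriv.symm
  have hFT1 : ∀ t ∈ I, ‖partialT F (0, t)‖ = 1 := fun t ht => by
    rw [hFT t ht, hF.norm_tangent ht]
  have h0U : ∀ t ∈ I, (0, t) ∈ U := fun t ht =>
    ⟨⟨h0ε, ht⟩, norm_ne_zero_iff.1 (by rw [hFT1 t ht]; exact one_ne_zero)⟩
  have hW := contDiffOn_momentum (p := p) hU hFU hne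
  have hWT : ∀ t ∈ I, momentum p F (0, t) = deriv γ t := fun t ht => by
    rw [momentum, hFT1 t ht, hFT t ht, Real.one_rpow, one_smul]
  have hWT' : ∀ t ∈ I, partialT (momentum p F) (0, t) = k • N t - γ t := fun t ht =>
    (hasDerivAt_partialT (hW.differentiableAt_of_isOpen hU (h0U t ht))).unique
      ((hF.hasDerivAt_tangent hI hγ ht).congr_of_eventuallyEq (hslice hWT ht))
  have hγγ : ∀ t ∈ I, ⟪γ t, γ t⟫ = 1 := fun t ht => by
    have h := hΦ.mem_sphere 0 h0ε t ht
    rw [hΦ.zero t ht, mem_sphere_zero_iff_norm] at h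
    rw [real_inner_self_eq_norm_sq, h, one_pow]
  have hWγ : ∀ t ∈ I, ⟪partialT (momentum p F) (0, t), F (0, t)⟫ = -1 := fun t ht => by
    rw [hWT' t ht, hFγ t ht, inner_sub_left, real_inner_smul_left, (hF.tangent t ht).2.1,
      hγγ t ht]
    ring
  have hP := contDiffOn_tensionField (p := p) hU hFU hne
  have hPN : ∀ t ∈ I, tensionField p F (0, t) = k • N t := fun t ht => by
    rw [tensionField, hWγ t ht, hWT' t ht, hFγ t ht]
    module
  -- The open set of parameters at which the energy density is smooth.
  set U' : Set (ℝ × ℝ) := U ∩ tensionField p F ⁻¹' {0}ᶜ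
  have hU' : IsOpen U' := hP.continuousOn.isOpen_inter_preimage hU isOpen_compl_singleton
  have h0U' : ∀ t ∈ I, (0, t) ∈ U' := fun t ht => by
    refine ⟨h0U t ht, ?_⟩
    have hN : N t ≠ 0 := norm_ne_zero_iff.1 (by simp [hF.norm_normal ht])
    simp only [mem_preimage, mem_compl_iff, mem_singleton_iff, hPN t ht, smul_eq_zero, not_or]
    exact ⟨hk.ne', hN⟩
  have hG : ContDiffOn ℝ ∞ (fun x => ‖tensionField p F x‖ ^ q) U' :=
    (hP.mono inter_subset_left).norm_rpow_of_ne_zero (fun x hx => hx.2) q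
  have hE := (hasDerivAt_setIntegral_Icc hU' hG fun t ht => h0U' t (hD ht)).const_mul (1 / q)
  have hEeq : (fun s => pqEnergy p q (Φ s) (Icc a b)) =ᶠ[𝓝 0]
      fun s => 1 / q * ∫ t in Icc a b, ‖tensionField p F (s, t)‖ ^ q := by
    filter_upwards [eventually_forall_Icc_mem_of_isOpen hU' fun t ht => h0U' t (hD ht)] with s hs
    rw [pqEnergy]
    congr 1
    exact setIntegral_congr_fun measurableSet_Icc fun t ht =>
      congrArg (fun v => ‖v‖ ^ q) (pTension_eq_tensionField hU hFU hne (hs t ht).1)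
  refine (hE.congr_of_eventuallyEq hEeq).congr_deriv ?_
  have hV : ∀ t ∈ I, deriv (fun s => Φ s t) 0 = partialS F (0, t) := fun t ht =>
    (hasDerivAt_partialS (hFU.differentiableAt_of_isOpen hU (h0U t ht))).deriv
  have hdens : ∀ t ∈ I, partialS (fun x => ‖tensionField p F x‖ ^ q) (0, t) =
      q * k ^ (q - 1) *
        (⟪N t, partialT (partialS (momentum p F)) (0, t)⟫ + ⟪N t, partialS F (0, t)⟫) := by
    intro t ht
    have h := (hasDerivAt_partialS (hP.differentiableAt_of_isOpen hU (h0U t ht)))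
      |>.norm_rpow_of_ne_zero (h0U' t ht).2 q
    rw [(hasDerivAt_partialS (hG.differentiableAt_of_isOpen hU' (h0U' t ht))).unique h,
      hPN t ht, real_inner_smul_left, inner_partialS_tensionField hU hFU hne (h0U t ht)
        (by rw [hFγ t ht]; exact (hF.tangent t ht).2.1), hWγ t ht, norm_smul,
      hF.norm_normal ht, mul_one, Real.norm_of_nonneg hk.le,
      show q - 1 = (q - 2) + 1 by ring, Real.rpow_add_one hk.ne']
    ring
  have hcont {f : ℝ × ℝ → E4} (hf : ContDiffOn ℝ ∞ f U) : ContinuousOn (fun t => f (0, t)) I :=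
    hf.continuousOn.comp (by fun_prop) h0U
  have hVS := hFU.partialS hU
  have hXS := hW.partialS hU
  -- The variation field and its derivative vanish outside `[a, b]`, hence at the endpoints.
  have hV0 : ∀ t ∈ I \ Icc a b, partialS F (0, t) = 0 := fun t ht => by
    have h : (fun s => F (s, t)) =ᶠ[𝓝 0] fun _ => γ t := by
      filter_upwards [isOpen_Ioo.mem_nhds h0ε] with s hs using hΦ.support s hs t ht
    exact (hasDerivAt_partialS (hFU.differentiableAt_of_isOpen hU (h0U t ht.1))).unique
      ((hasDerivAt_const 0 (γ t)).congr_of_eventuallyEq h)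
  have hV0' : ∀ t ∈ I \ Icc a b, partialT (partialS F) (0, t) = 0 := fun t ht => by
    have h : (fun t => partialS F (0, t)) =ᶠ[𝓝 t] fun _ => 0 := by
      filter_upwards [(hI.sdiff isClosed_Icc).mem_nhds ht] with u hu using hV0 u hu
    exact (hasDerivAt_partialT (hVS.differentiableAt_of_isOpen hU (h0U t ht.1))).unique
      ((hasDerivAt_const t (0 : E4)).congr_of_eventuallyEq h)
  have hX : ∀ t ∈ I, partialS (momentum p F) (0, t) =
      ((p - 2) * ⟪deriv γ t, partialT (partialS F) (0, t)⟫) • deriv γ t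
        + partialT (partialS F) (0, t) := fun t ht => by
    rw [partialS_momentum hU hFU hne (h0U t ht) (hFT1 t ht), hFT t ht]
  obtain ⟨hVa, hVb⟩ := eq_zero_endpoints hI (hcont hVS) hab hD hV0
  obtain ⟨hXa, hXb⟩ := eq_zero_endpoints hI (hcont hXS) hab hD fun t ht => by
    rw [hX t ht.1, hV0' t ht]
    simp
  -- The varied curves stay in the sphere, so the variation field is tangent to it.
  have hVγ : ∀ t ∈ I, ⟪partialS F (0, t), γ t⟫ = 0 := fun t ht => by
    have h := (hasDerivAt_partialS (hFU.differentiableAt_of_isOpen hU (h0U t ht))).norm_sq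
    have h1 : (fun s => ‖F (s, t)‖ ^ 2) =ᶠ[𝓝 0] fun _ => 1 := by
      filter_upwards [isOpen_Ioo.mem_nhds h0ε] with s hs
      rw [mem_sphere_zero_iff_norm.1 (hΦ.mem_sphere s hs t ht), one_pow]
    have h2 := h.unique ((hasDerivAt_const 0 (1 : ℝ)).congr_of_eventuallyEq h1)
    rw [hFγ t ht, real_inner_comm] at h2
    linarith
  have hibp := hF.integral_inner_normal (p := p) hI hγ hab hD
    (fun t ht => hasDerivAt_partialT (hVS.differentiableAt_of_isOpen hU (h0U t ht)))
    (fun t ht => hasDerivAt_partialT (hXS.differentiableAt_of_isOpen hU (h0U t ht)))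
    (hcont (hXS.partialT hU)) hX hVγ hVa hVb hXa hXb
  have hVint : ∫ t in Icc a b, ⟪N t, deriv (fun s => Φ s t) 0⟫ =
      ∫ t in Icc a b, ⟪N t, partialS F (0, t)⟫ :=
    setIntegral_congr_fun measurableSet_Icc fun t ht =>
      congrArg (fun v => ⟪N t, v⟫) (hV t (hD ht))
  rw [setIntegral_congr_fun measurableSet_Icc fun t ht => hdens t (hD ht), integral_const_mul,
    hibp, hVint]
  field_simp

/-- Moving each point of a curve along the great circle in the direction of the unit normal `n`, at
a speed prescribed by a cutoff function `φ`, is a variation of the curve. -/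
lemma isVariation_greatCircle (hγ : ContDiffOn ℝ ∞ γ I) (hS : ∀ t ∈ I, γ t ∈ S3) {n : ℝ → E4}
    (hn : ContDiffOn ℝ ∞ n I) (hn1 : ∀ t ∈ I, ‖n t‖ = 1) (hnγ : ∀ t ∈ I, ⟪n t, γ t⟫ = 0)
    {φ : ℝ → ℝ} (hφ : ContDiff ℝ ∞ φ) {D : Set ℝ} (hφD : ∀ t ∉ D, φ t = 0) :
    IsVariation I D γ 1 fun s t => Real.cos (s * φ t) • γ t + Real.sin (s * φ t) • n t where
  eps_pos := one_pos
  smooth := by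
    have hsnd : MapsTo Prod.snd (Ioo (-1 : ℝ) 1 ×ˢ I) I := fun x hx => hx.2
    have harg : ContDiff ℝ ∞ fun x : ℝ × ℝ => x.1 * φ x.2 :=
      contDiff_fst.mul (hφ.comp contDiff_snd)
    exact (harg.cos.contDiffOn.smul (hγ.comp contDiff_snd.contDiffOn hsnd)).add
      (harg.sin.contDiffOn.smul (hn.comp contDiff_snd.contDiffOn hsnd))
  mem_sphere s _ t ht := by
    have hγ1 : ‖γ t‖ = 1 := mem_sphere_zero_iff_norm.1 (hS t ht)
    have hγn : ⟪γ t, n t⟫ = 0 := by rw [real_inner_comm, hnγ t ht]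
    rw [mem_sphere_zero_iff_norm, ← sq_eq_sq₀ (norm_nonneg _) zero_le_one, norm_add_sq_real]
    simp only [norm_smul, hγ1, hn1 t ht, real_inner_smul_left, real_inner_smul_right, hγn,
      Real.norm_eq_abs, mul_one, sq_abs, mul_zero, add_zero, Real.cos_sq_add_sin_sq, one_pow]
  zero t _ := by simp
  support s _ t ht := by simp [hφD t ht.2]

/-- The variation by a bump function `φ` along the normal has `∫ ⟪N, V⟫ = ∫ φ > 0`, so at a critical
point the constant factor in the first variation formula has to vanish. -/
lemma IsFrenetFrame.eq_zero_of_isPQHarmonic {p q k τ : ℝ} (hq : q ≠ 0)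
    (hF : IsFrenetFrame I γ N B (fun _ => k) fun _ => τ) (hI : IsOpen I) (hne : I.Nonempty)
    (hγ : ContDiffOn ℝ ∞ γ I) (hS : ∀ t ∈ I, γ t ∈ S3) (hk : 0 < k) (h : IsPQHarmonic p q I γ) :
    1 - τ ^ 2 - k ^ 2 * (p - 1) = 0 := by
  obtain ⟨c, hc⟩ := hne
  obtain ⟨r, hr, hball⟩ := Metric.nhds_basis_closedBall.mem_iff.1 (hI.mem_nhds hc)
  rw [Real.closedBall_eq_Icc] at hball
  let φ : ContDiffBump c := ⟨r / 2, r, by positivity, by linarith⟩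
  have hφD : ∀ t ∉ Icc (c - r) (c + r), φ t = 0 := fun t ht => by
    rw [← Real.closedBall_eq_Icc, Metric.mem_closedBall, not_le] at ht
    exact φ.zero_of_le_dist ht.le
  have hvar := isVariation_greatCircle hγ hS hF.smooth_N (fun t ht => hF.norm_normal ht)
    (fun t ht => (hF.tangent t ht).2.1) φ.contDiff hφD
  have h0 := (h (c - r) (c + r) (by linarith) hball 1 _ hvar).unique
    (hF.hasDerivAt_pqEnergy hq hI hγ hk (by linarith) hball hvar)
  have hVφ : ∀ t ∈ I, ⟪N t, deriv (fun s : ℝ =>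
      Real.cos (s * φ t) • γ t + Real.sin (s * φ t) • N t) 0⟫ = φ t := fun t ht => by
    have harg : HasDerivAt (fun s : ℝ => s * φ t) (φ t) 0 := by
      simpa using (hasDerivAt_id (0 : ℝ)).mul_const (φ t)
    have hd := (harg.cos.smul_const (γ t)).add (harg.sin.smul_const (N t))
    have hd' := hd.deriv
    simp only [zero_mul, Real.sin_zero, neg_zero, zero_smul, Real.cos_zero, one_mul,
      zero_add] at hd'
    change ⟪N t, deriv ((fun s : ℝ => Real.cos (s * φ t) • γ t) +
      fun s => Real.sin (s * φ t) • N t) 0⟫ = φ t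
    rw [hd', real_inner_smul_right, real_inner_self_eq_norm_sq, hF.norm_normal ht]
    ring
  have hpos : 0 < ∫ t in Icc (c - r) (c + r), φ t := by
    rw [setIntegral_eq_integral_of_forall_compl_eq_zero hφD]
    exact φ.integral_pos
  rw [setIntegral_congr_fun measurableSet_Icc fun t ht => hVφ t (hball ht)] at h0
  rcases mul_eq_zero.1 h0.symm with h1 | h1
  · exact absurd h1 (Real.rpow_pos_of_pos hk _).ne'
  · exact (mul_eq_zero.1 h1).resolve_right hpos.ne'

end FirstVariation

/-! ### The characterization of proper `(p,q)`-harmonic curves -/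

theorem mainTheorem7 (p q : ℝ) (hp : 1 < p) (hq : 1 < q)
    (I : Set ℝ) (hI_open : IsOpen I) (hI_interval : I.OrdConnected) (hI_nonempty : I.Nonempty)
    (γ : ℝ → E4) (hγ_smooth : ContDiffOn ℝ ∞ γ I) (hγ_sphere : ∀ t ∈ I, γ t ∈ S3)
    (k τ : ℝ) (hkτ : HasCurvatureTorsion I γ (fun _ => k) (fun _ => τ)) :
    IsProperPQHarmonic p q I γ ↔
      0 < k ∧ τ ^ 2 < 1 ∧ p = (1 - τ ^ 2) / k ^ 2 + 1 := by
  obtain ⟨N, B, hF⟩ := hkτ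
  have hq0 : q ≠ 0 := by positivity
  constructor
  · rintro ⟨hcrit, hproper⟩
    rw [hF.isPHarmonic_iff hI_open hI_nonempty] at hproper
    obtain ⟨t, ht⟩ := hI_nonempty
    have hk : 0 < k := (hF.curvature_nonneg t ht).lt_of_ne' hproper
    have hc := hF.eq_zero_of_isPQHarmonic hq0 hI_open ⟨t, ht⟩ hγ_smooth hγ_sphere hk hcrit
    have hpos : 0 < k ^ 2 * (p - 1) := mul_pos (by positivity) (sub_pos.2 hp)
    refine ⟨hk, by linarith, ?_⟩
    field_simp
    linarith
  · rintro ⟨hk, -, hpk⟩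
    have hc : 1 - τ ^ 2 - k ^ 2 * (p - 1) = 0 := by
      rw [hpk]
      field_simp
      ring
    refine ⟨fun a b hab hD ε Φ hΦ => ?_, ?_⟩
    · simpa only [hc, zero_mul, mul_zero] using
        hF.hasDerivAt_pqEnergy (p := p) hq0 hI_open hγ_smooth hk hab.le hD hΦ
    · rw [hF.isPHarmonic_iff hI_open hI_nonempty]
      exact hk.ne'
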